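/- **Setting.** Let $K_0$ be the Macdonald function of order zero, $K_0(s)=\int_0^\infty e^{-s\cosh t}\,dt$ for $s>0$, and for $a>0$ and $x\in\mathbb{R}^2\setminus\{0\}$ write $K_0(ax)$ for $K_0(a|x|)$. Let $$\mathcal{D}=\Big\{U=(u,v)\ :\ u\in H^1(\mathbb{R}),\ v=\phi+q\,\tfrac{K_0}{2\pi}\text{ for some }\phi\in H^1(\mathbb{R}^2),\ q\in\mathbb{C}\Big\}$$ (complex-valued functions, equalities almost everywhere), where $q$ is called the charge of $v$, and for $\mu>0$ let $$\mathcal{D}^\mu=\Big\{U=(u,v)\in\mathcal{D}\ :\ \int_{\mathbb{R}}|u|^2+\int_{\mathbb{R}^2}|v|^2=\mu\Big\}.$$ For $v$ with charge $q$, define $\phi_q$ by $$v(x)=\begin{cases}\phi_q(x)+q\,\dfrac{K_0(|q|x)}{2\pi}, & q\neq0,\\ \phi_0(x), & q=0.\end{cases}$$ **Proposition 3.1 (Gagliardo–Nirenberg estimate).** Let $2<p<6$, $2<r<4$ and $\mu>0$. There are finite constants $C_{p,\mu}$ and $C_{r,\mu}$, depending only on $(p,\mu)$ and on $(r,\mu)$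 respectively, such that for every $U=(u,v)\in\mathcal{D}^\mu$, with $v$ of charge $q$, one has $\phi_q\in H^1(\mathbb{R}^2)$ and $$\|u\|_{L^p(\mathbb{R})}^p\le C_{p,\mu}\,\|u'\|_{L^2(\mathbb{R})}^{\frac p2-1},\qquad \|v\|_{L^r(\mathbb{R}^2)}^r\le C_{r,\mu}\Big(\|\nabla\phi_q\|_{L^2(\mathbb{R}^2)}^{r-2}+|q|^{r-2}\Big).$$ -/

import Mathlib

open MeasureTheory
open scoped ENNReal NNReal ContDiff

/-- The Euclidean plane `ℝ²`. -/
abbrev Plane : Type := EuclideanSpace ℝ (Fin 2)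

/-- The Macdonald function (modified Bessel function of the second kind) of order zero,
`K₀(s) = ∫₀^∞ exp(-s cosh t) dt` for `s > 0`. -/
noncomputable def besselK0 (s : ℝ) : ℝ :=
  ∫ t in Set.Ioi (0 : ℝ), Real.exp (-(s * Real.cosh t))

/-- The function `x ↦ K₀(a x) / (2 π)` on the plane, with `K₀(a x)` meaning `K₀(a |x|)`. -/
noncomputable def greenK0 (a : ℝ) (x : Plane) : ℂ :=
  ((besselK0 (a * ‖x‖) / (2 * Real.pi) : ℝ) : ℂ)

/-- `u ∈ H¹(ℝ)` with weak derivative `u'`. -/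
structure IsH1Line (u u' : ℝ → ℂ) : Prop where
  memLp : MemLp u 2 volume
  memLp_deriv : MemLp u' 2 volume
  weak_deriv : ∀ η : ℝ → ℝ, ContDiff ℝ ∞ η → HasCompactSupport η →
    ∫ x, deriv η x • u x = -∫ x, η x • u' x

/-- `φ ∈ H¹(ℝ²)` with weak gradient `G = ∇φ`. -/
structure IsH1Plane (φ : Plane → ℂ) (G : Plane → EuclideanSpace ℂ (Fin 2)) : Prop where
  memLp : MemLp φ 2 volume
  memLp_grad : MemLp G 2 volume
  weak_grad : ∀ η : Plane → ℝ, ContDiff ℝ ∞ η → HasCompactSupport η → ∀ i : Fin 2,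
    ∫ x, fderiv ℝ η x (EuclideanSpace.single i 1) • φ x = -∫ x, η x • G x i

/-- `v = φ + q K₀ / (2 π)` (almost everywhere) for some `φ ∈ H¹(ℝ²)`: the function `v` belongs to
the planar energy domain and has charge `q`. -/
def HasCharge (v : Plane → ℂ) (q : ℂ) : Prop :=
  ∃ φ G, IsH1Plane φ G ∧ v =ᵐ[volume] fun x => φ x + q * greenK0 1 x

/-- The energy domain `𝒟` of the hybrid, as a set of pairs `U = (u, v)`. -/
def energyDomain : Set ((ℝ → ℂ) × (Plane → ℂ)) :=
  {U | (∃ u', IsH1Line U.1 u') ∧ ∃ q, HasCharge U.2 q}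

/-- The elements of the energy domain of mass `∫ |u|² + ∫ |v|² = μ`. -/
def energyDomainMass (μ : ℝ) : Set ((ℝ → ℂ) × (Plane → ℂ)) :=
  {U | U ∈ energyDomain ∧
    (∫⁻ x, ‖U.1 x‖ₑ ^ 2) + (∫⁻ x, ‖U.2 x‖ₑ ^ 2) = ENNReal.ofReal μ}

/-- The function `φ_q` defined by `v(x) = φ_q(x) + q K₀(|q| x) / (2 π)` if `q ≠ 0`,
and by `v = φ₀` if `q = 0`. -/
noncomputable def regularPart (v : Plane → ℂ) (q : ℂ) (x : Plane) : ℂ :=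
  open Classical in if q = 0 then v x else v x - q * greenK0 ‖q‖ x

/-! On the line, integrating `(u²)' = 2uu'` gives `|u|² ≤ 2 ‖u‖₂ ‖u'‖₂` almost everywhere; then
`|u|^p = (|u|²)^(p/2-1) |u|²` and the mass bounds `‖u‖₂`.

In the plane, write `v = φ_q + q G_{|q|}` with `G_a = K₀(a|·|)/(2π)`. Dilation gives `‖q
G_{|q|}‖_r^r = |q|^(r-2) ‖G_1‖_r^r` (`eLpNorm_charge_mul_greenK0_rpow`). At `r = 2` this does not
depend on `q`, so `‖φ_q‖₂` is bounded by the mass alone. The Gagliardo–Nirenberg inequality `‖f‖_r^r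
≤ C ‖f‖₂² ‖∇f‖₂^(r-2)` (`exists_eLpNorm_rpow_le_plane`), interpolated from Ladyzhenskaya's `L⁴`
bound, handles `φ_q`.

That `φ_q` lies in `H¹` reduces to `G_1 - G_{|q|} ∈ H¹` (`exists_isH1Plane_greenK0_sub`): the
logarithmic singularities cancel, leaving a Lipschitz function whose local slope decays
exponentially. -/

open Filter Topology
open scoped Convolution

/-! ### Mollification and cutoff of functions with weak derivatives in `L²`. -/

section WeakDerivative

variable {E : Type*} [NormedAddCommGroup E] [NormedSpace ℝ E] [FiniteDimensional ℝ E]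
  [MeasurableSpace E] [BorelSpace E]

theorem eLpNorm_two_sq_eq_lintegral {α F : Type*} [MeasurableSpace α] [NormedAddCommGroup F]
    (f : α → F) (μ : Measure α) : eLpNorm f 2 μ ^ 2 = ∫⁻ x, ‖f x‖ₑ ^ 2 ∂μ := by
  have := eLpNorm_nnreal_pow_eq_lintegral (μ := μ) (f := f) (p := 2) two_ne_zero
  simpa using this

theorem lintegral_mul_le_eLpNorm_two {α F G : Type*} [MeasurableSpace α] [NormedAddCommGroup F]
    [NormedAddCommGroup G] {μ : Measure α} {f : α → F} {g : α → G}
    (hf : AEStronglyMeasurable f μ) (hg : AEStronglyMeasurable g μ) :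
    ∫⁻ x, ‖f x‖ₑ * ‖g x‖ₑ ∂μ ≤ eLpNorm f 2 μ * eLpNorm g 2 μ := by
  have h := ENNReal.lintegral_mul_le_Lp_mul_Lq μ Real.HolderConjugate.two_two hf.enorm hg.enorm
  simpa [eLpNorm_eq_lintegral_rpow_enorm_toReal] using h

/-- `g` is the weak derivative of `f` in the direction `e`. -/
def HasWeakLineDeriv (μ : Measure E) (f g : E → ℂ) (e : E) : Prop :=
  ∀ η : E → ℝ, ContDiff ℝ ∞ η → HasCompactSupport η →
    ∫ x, fderiv ℝ η x e • f x ∂μ = -∫ x, η x • g x ∂μ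

variable {μ : Measure E} [μ.IsAddHaarMeasure]

/-- Averaging against a probability density is a contraction of `L²`. -/
theorem eLpNorm_convolution_le {ρ : E → ℝ} (hρ : Continuous ρ) (hρ1 : ∫⁻ x, ‖ρ x‖ₑ ∂μ = 1)
    {f : E → ℂ} (hf : AEStronglyMeasurable f μ) :
    eLpNorm (ρ ⋆[ContinuousLinearMap.lsmul ℝ ℝ, μ] f) 2 μ ≤ eLpNorm f 2 μ := by
  have hmeas : AEMeasurable (Function.uncurry fun x t => ‖ρ t‖ₑ * ‖f (x - t)‖ₑ ^ 2) (μ.prod μ) := by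
    have h1 : AEMeasurable (fun z : E × E => ‖ρ z.2‖ₑ) (μ.prod μ) :=
      (hρ.measurable.comp measurable_snd).enorm.aemeasurable
    have h2 : AEMeasurable (fun z : E × E => ‖f (z.1 - z.2)‖ₑ) (μ.prod μ) :=
      (hf.comp_quasiMeasurePreserving (quasiMeasurePreserving_sub_of_right_invariant μ μ)).enorm
    exact h1.mul (h2.pow_const 2)
  have key : ∀ x, ‖(ρ ⋆[ContinuousLinearMap.lsmul ℝ ℝ, μ] f) x‖ₑ ^ 2 ≤
      ∫⁻ t, ‖ρ t‖ₑ * ‖f (x - t)‖ₑ ^ 2 ∂μ := by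
    intro x
    have hfx : AEMeasurable (fun t => ‖f (x - t)‖ₑ) μ :=
      (hf.comp_quasiMeasurePreserving (quasiMeasurePreserving_sub_left μ x)).enorm
    have h1 : ‖(ρ ⋆[ContinuousLinearMap.lsmul ℝ ℝ, μ] f) x‖ₑ ≤
        ∫⁻ t, ‖ρ t‖ₑ * ‖f (x - t)‖ₑ ∂μ := by
      rw [convolution_def]
      refine (enorm_integral_le_lintegral_enorm _).trans (le_of_eq ?_)
      simp only [ContinuousLinearMap.lsmul_apply, enorm_smul]
    -- Cauchy–Schwarz for the splitting `ρ|f| = ρ^(1/2) (ρ|f|²)^(1/2)`; the first factor integrates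
    -- to one.
    have h2 := ENNReal.lintegral_mul_norm_pow_le (μ := μ) (f := fun t => ‖ρ t‖ₑ)
      (g := fun t => ‖ρ t‖ₑ * ‖f (x - t)‖ₑ ^ 2) (p := 1 / 2) (q := 1 / 2)
      hρ.measurable.enorm.aemeasurable
      (hρ.measurable.enorm.aemeasurable.mul (hfx.pow_const _)) (by norm_num) (by norm_num)
      (by norm_num)
    have h3 : ∀ t, ‖ρ t‖ₑ ^ (1 / 2 : ℝ) * (‖ρ t‖ₑ * ‖f (x - t)‖ₑ ^ 2) ^ (1 / 2 : ℝ) =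
        ‖ρ t‖ₑ * ‖f (x - t)‖ₑ := by
      intro t
      rw [ENNReal.mul_rpow_of_nonneg _ _ (by norm_num), ← mul_assoc,
        ← ENNReal.rpow_add_of_nonneg _ _ (by norm_num) (by norm_num), ← ENNReal.rpow_natCast,
        ← ENNReal.rpow_mul]
      norm_num
    simp only [h3, hρ1, ENNReal.one_rpow, one_mul] at h2
    calc _ ≤ ((∫⁻ t, ‖ρ t‖ₑ * ‖f (x - t)‖ₑ ^ 2 ∂μ) ^ (1 / 2 : ℝ)) ^ 2 := by
          gcongr; exact h1.trans h2
      _ = _ := by rw [← ENNReal.rpow_natCast, ← ENNReal.rpow_mul]; norm_num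
  rw [← ENNReal.pow_le_pow_left_iff two_ne_zero, eLpNorm_two_sq_eq_lintegral,
    eLpNorm_two_sq_eq_lintegral]
  calc _ ≤ ∫⁻ x, ∫⁻ t, ‖ρ t‖ₑ * ‖f (x - t)‖ₑ ^ 2 ∂μ ∂μ := lintegral_mono key
    _ = ∫⁻ t, ∫⁻ x, ‖ρ t‖ₑ * ‖f (x - t)‖ₑ ^ 2 ∂μ ∂μ := lintegral_lintegral_swap hmeas
    _ = ∫⁻ t, ‖ρ t‖ₑ * ∫⁻ x, ‖f x‖ₑ ^ 2 ∂μ ∂μ := by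
        refine lintegral_congr fun t => ?_
        rw [lintegral_const_mul' _ _ (by simp),
          lintegral_sub_right_eq_self (fun x => ‖f x‖ₑ ^ 2) t]
    _ = _ := by rw [lintegral_mul_const _ hρ.measurable.enorm, hρ1, one_mul]

/-- Weak derivatives commute with mollification. -/
theorem HasWeakLineDeriv.fderiv_convolution {f g : E → ℂ} {e : E} (h : HasWeakLineDeriv μ f g e)
    (hf : LocallyIntegrable f μ) {ρ : E → ℝ} (hρ : ContDiff ℝ ∞ ρ) (hρc : HasCompactSupport ρ)
    (x : E) :
    fderiv ℝ (ρ ⋆[ContinuousLinearMap.lsmul ℝ ℝ, μ] f) x e =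
      (ρ ⋆[ContinuousLinearMap.lsmul ℝ ℝ, μ] g) x := by
  have hρ1 : ContDiff ℝ 1 ρ := hρ.of_le (by exact_mod_cast le_top)
  rw [(hρc.hasFDerivAt_convolution_left _ hρ1 hf x).fderiv]
  have hex : ConvolutionExistsAt (fderiv ℝ ρ) f x
      ((ContinuousLinearMap.lsmul ℝ ℝ : ℝ →L[ℝ] ℂ →L[ℝ] ℂ).precompL E) μ :=
    (hρc.fderiv ℝ).convolutionExists_left _ (hρ1.continuous_fderiv one_ne_zero) hf x
  rw [convolution_def, ContinuousLinearMap.integral_apply hex]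
  have h1 : ∀ t, ((ContinuousLinearMap.lsmul ℝ ℝ : ℝ →L[ℝ] ℂ →L[ℝ] ℂ).precompL E)
      (fderiv ℝ ρ t) (f (x - t)) e = fderiv ℝ ρ t e • f (x - t) := fun t => by
    simp [ContinuousLinearMap.precompL_apply]
  simp only [h1]
  have h2 : ∫ t, fderiv ℝ ρ t e • f (x - t) ∂μ = ∫ y, fderiv ℝ ρ (x - y) e • f y ∂μ := by
    rw [← integral_sub_left_eq_self _ μ x]; simp
  have h3 : ∀ y, fderiv ℝ (fun y => ρ (x - y)) y e = -fderiv ℝ ρ (x - y) e := by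
    intro y
    have hd : HasFDerivAt (fun y => ρ (x - y)) _ y :=
      HasFDerivAt.comp y ((hρ1.differentiable one_ne_zero) (x - y)).hasFDerivAt
        ((hasFDerivAt_id y).const_sub x)
    rw [hd.fderiv]; simp
  -- The test function is the reflected kernel; its chain-rule sign cancels the sign of the weak
  -- derivative.
  have h4 := h (fun y => ρ (x - y)) (hρ.comp (contDiff_const.sub contDiff_id))
    (hρc.comp_homeomorph (Homeomorph.subLeft x))
  simp only [h3, neg_smul, integral_neg, neg_inj] at h4
  rw [h2, h4, convolution_def, ← integral_sub_left_eq_self _ μ x]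
  simp

/-- Mollify at scale `1/(n+1)`, then multiply by `χ(x/(n+1))`. Differentiating the cutoff costs a
term of order `‖f‖₂/(n+1)`, which is `δ n`. Norm bounds and convergence almost everywhere suffice,
since the inequalities are passed to the limit pointwise or by Fatou. -/
theorem exists_contDiff_compactSupport_approx {ι : Type*} {f : E → ℂ} {e : ι → E} {g : ι → E → ℂ}
    (hf : MemLp f 2 μ) (hg : ∀ i, MemLp (g i) 2 μ) (h : ∀ i, HasWeakLineDeriv μ f (g i) (e i)) :
    ∃ w : ℕ → E → ℂ, (∀ n, ContDiff ℝ 1 (w n)) ∧ (∀ n, HasCompactSupport (w n)) ∧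
      (∀ n, eLpNorm (w n) 2 μ ≤ eLpNorm f 2 μ) ∧
      (∀ i, ∃ δ : ℕ → ℝ≥0∞, Tendsto δ atTop (𝓝 0) ∧
        ∀ n, eLpNorm (fun x => fderiv ℝ (w n) x (e i)) 2 μ ≤ eLpNorm (g i) 2 μ + δ n) ∧
      ∀ᵐ x ∂μ, Tendsto (fun n => w n x) atTop (𝓝 (f x)) := by
  let φ : ℕ → ContDiffBump (0 : E) := fun n =>
    ⟨1 / ((n : ℝ) + 1), 2 / ((n : ℝ) + 1), by positivity, by gcongr; norm_num⟩
  obtain ⟨χ, hχ, hχc, hψ1, hχ0⟩ : ∃ χ : E → ℝ, ContDiff ℝ 1 χ ∧ HasCompactSupport χ ∧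
      (∀ y, ‖χ y‖ ≤ 1) ∧ ∀ᶠ y in 𝓝 0, χ y = 1 := by
    let χ : ContDiffBump (0 : E) := ⟨1, 2, one_pos, one_lt_two⟩
    refine ⟨χ, χ.contDiff, χ.hasCompactSupport, fun y => ?_, χ.eventuallyEq_one⟩
    rw [Real.norm_eq_abs, abs_of_nonneg χ.nonneg]
    exact χ.le_one
  let c : ℕ → ℝ := fun n => ((n : ℝ) + 1)⁻¹
  have hc : ∀ n, 0 < c n := fun n => by positivity
  let m : ℕ → E → ℂ := fun n => (φ n).normed μ ⋆[ContinuousLinearMap.lsmul ℝ ℝ, μ] f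
  have hfl : LocallyIntegrable f μ := hf.locallyIntegrable one_le_two
  have hρ : ∀ n, ContDiff ℝ ∞ ((φ n).normed μ) := fun n => (φ n).contDiff_normed
  have hρc : ∀ n, HasCompactSupport ((φ n).normed μ) := fun n => (φ n).hasCompactSupport_normed
  have hρ1 : ∀ n, ∫⁻ x, ‖(φ n).normed μ x‖ₑ ∂μ = 1 := fun n => by
    rw [← ofReal_integral_norm_eq_lintegral_enorm (φ n).integrable_normed]
    simp [abs_of_nonneg ((φ n).nonneg_normed _), (φ n).integral_normed]
  have hm : ∀ n, ContDiff ℝ 1 (m n) := fun n =>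
    ((hρc n).contDiff_convolution_left (n := ⊤) _ (hρ n) hfl).of_le (by exact_mod_cast le_top)
  have hm2 : ∀ n, eLpNorm (m n) 2 μ ≤ eLpNorm f 2 μ := fun n =>
    eLpNorm_convolution_le (hρ n).continuous (hρ1 n) hf.1
  have hmd : ∀ n i, eLpNorm (fun x => fderiv ℝ (m n) x (e i)) 2 μ ≤ eLpNorm (g i) 2 μ := by
    intro n i
    simp only [m, (h i).fderiv_convolution hfl (hρ n) (hρc n)]
    exact eLpNorm_convolution_le (hρ n).continuous (hρ1 n) (hg i).1
  obtain ⟨A, hA⟩ := (hχc.fderiv ℝ).exists_bound_of_continuous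
    (hχ.continuous_fderiv one_ne_zero)
  have hψd : ∀ n x, HasFDerivAt (fun x => χ (c n • x)) (c n • fderiv ℝ χ (c n • x)) x := by
    intro n x
    have hd : HasFDerivAt (fun x => χ (c n • x)) _ x :=
      HasFDerivAt.comp x ((hχ.differentiable one_ne_zero) (c n • x)).hasFDerivAt
        ((hasFDerivAt_id x).const_smul (c n))
    exact hd.congr_fderiv (by ext v; simp)
  have hψ : ∀ n, ContDiff ℝ 1 fun x => χ (c n • x) := fun n =>
    hχ.comp (contDiff_const_smul (c n))
  have hψc : ∀ n, HasCompactSupport fun x => χ (c n • x) := fun n =>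
    hχc.comp_smul (hc n).ne'
  refine ⟨fun n x => χ (c n • x) • m n x, fun n => (hψ n).smul (hm n),
    fun n => (hψc n).smul_right, fun n => ?_, fun i => ?_, ?_⟩
  · refine (eLpNorm_mono fun x => ?_).trans (hm2 n)
    rw [norm_smul]
    exact mul_le_of_le_one_left (norm_nonneg _) (hψ1 _)
  · refine ⟨fun n => ENNReal.ofReal (c n * A * ‖e i‖) * eLpNorm f 2 μ, ?_, fun n => ?_⟩
    · have h1 : Tendsto (fun n => c n * A * ‖e i‖) atTop (𝓝 0) := by
        have : Tendsto c atTop (𝓝 0) := by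
          simpa [c] using tendsto_one_div_add_atTop_nhds_zero_nat (𝕜 := ℝ)
        simpa using (this.mul_const A).mul_const ‖e i‖
      have h2 := ENNReal.tendsto_ofReal h1
      simpa using ENNReal.Tendsto.mul_const h2 (b := eLpNorm f 2 μ) (Or.inr hf.2.ne)
    · have hd : (fun x => fderiv ℝ (fun x => χ (c n • x) • m n x) x (e i)) =
          (fun x => χ (c n • x) • fderiv ℝ (m n) x (e i)) +
            fun x => (c n * fderiv ℝ χ (c n • x) (e i)) • m n x := by
        ext1 x
        have := (hψd n x).smul ((hm n).differentiable one_ne_zero x).hasFDerivAt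
        change fderiv ℝ ((fun x => χ (c n • x)) • m n) x (e i) = _
        rw [this.fderiv]
        simp
      have hcont : Continuous fun x => fderiv ℝ (m n) x (e i) :=
        ((hm n).continuous_fderiv one_ne_zero).clm_apply continuous_const
      have hcont' : Continuous fun x => fderiv ℝ χ (c n • x) (e i) :=
        (((hχ.continuous_fderiv one_ne_zero)).comp (continuous_const_smul _)).clm_apply
          continuous_const
      rw [hd]
      refine (eLpNorm_add_le ((hψ n).continuous.smul hcont).aestronglyMeasurable
        ((continuous_const.mul hcont').smul (hm n).continuous).aestronglyMeasurable
        one_le_two).trans ?_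
      gcongr
      · refine (eLpNorm_mono fun x => ?_).trans (hmd n i)
        refine (norm_smul (χ (c n • x)) (fderiv ℝ (m n) x (e i))).trans_le ?_
        exact mul_le_of_le_one_left (norm_nonneg _) (hψ1 _)
      · refine (eLpNorm_le_mul_eLpNorm_of_ae_le_mul (g := m n) (c := c n * A * ‖e i‖)
          (ae_of_all _ fun x => ?_) 2).trans (mul_le_mul_right (hm2 n) _)
        refine (norm_smul (c n * fderiv ℝ χ (c n • x) (e i)) (m n x)).trans_le ?_
        rw [norm_mul, Real.norm_of_nonneg (hc n).le, mul_assoc (c n) A]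
        exact mul_le_mul_of_nonneg_right (mul_le_mul_of_nonneg_left
          ((fderiv ℝ χ (c n • x)).le_of_opNorm_le (hA _) (e i)) (hc n).le) (norm_nonneg _)
  · have hrout : Tendsto (fun n => (φ n).rOut) atTop (𝓝 0) := by
      have := (tendsto_one_div_add_atTop_nhds_zero_nat (𝕜 := ℝ)).const_mul 2
      simpa [φ, mul_one_div, div_eq_mul_inv] using this
    -- Lebesgue differentiation; it needs outer radii comparable to inner ones, here with ratio 2.
    have hlim := ContDiffBump.ae_convolution_tendsto_right_of_locallyIntegrable (μ := μ) (K := 2)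
      hrout (Eventually.of_forall fun n => by simp [φ, div_eq_mul_inv]) hfl
    filter_upwards [hlim] with x hx
    refine hx.congr' ?_
    have h1 : Tendsto (fun n => c n • x) atTop (𝓝 0) := by
      have : Tendsto c atTop (𝓝 0) := by
        simpa [c] using tendsto_one_div_add_atTop_nhds_zero_nat (𝕜 := ℝ)
      simpa using this.smul_const x
    filter_upwards [h1.eventually hχ0] with n hn
    simp [hn, m]

end WeakDerivative

/-! ### Gagliardo–Nirenberg inequalities on the line and in the plane. -/

section GagliardoNirenberg

theorem HasCompactSupport.sq {E : Type*} [TopologicalSpace E] {w : E → ℂ}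
    (hw : HasCompactSupport w) : HasCompactSupport fun x => w x ^ 2 :=
  hw.comp_left (g := fun z : ℂ => z ^ 2) (by simp)

/-- Cauchy–Schwarz for `2w∇w`. It lets inequalities that control a function by the `L¹` norm of its
gradient be applied to `w²`. -/
theorem lintegral_enorm_fderiv_sq_le {E : Type*} [NormedAddCommGroup E] [NormedSpace ℝ E]
    [FiniteDimensional ℝ E] [MeasurableSpace E] [BorelSpace E] (μ : Measure E) {w : E → ℂ}
    (hw : ContDiff ℝ 1 w) :
    ∫⁻ x, ‖fderiv ℝ (fun x => w x ^ 2) x‖ₑ ∂μ ≤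
      2 * (eLpNorm w 2 μ * eLpNorm (fderiv ℝ w) 2 μ) := by
  have h : ∀ x, ‖fderiv ℝ (fun x => w x ^ 2) x‖ₑ ≤ 2 * (‖w x‖ₑ * ‖fderiv ℝ w x‖ₑ) := fun x => by
    have hd : HasFDerivAt (fun x => w x ^ 2) _ x :=
      ((hw.differentiable one_ne_zero) x).hasFDerivAt.pow 2
    rw [hd.fderiv]
    refine (enorm_smul _ _).trans_le (le_of_eq ?_)
    have h2 : ‖(2 : ℂ)‖ₑ = 2 := by rw [← ofReal_norm]; simp
    simp [h2, mul_assoc]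
  calc _ ≤ ∫⁻ x, 2 * (‖w x‖ₑ * ‖fderiv ℝ w x‖ₑ) ∂μ := lintegral_mono h
    _ = 2 * ∫⁻ x, ‖w x‖ₑ * ‖fderiv ℝ w x‖ₑ ∂μ := lintegral_const_mul' _ _ (by simp)
    _ ≤ _ := by
        gcongr
        exact lintegral_mul_le_eLpNorm_two hw.continuous.aestronglyMeasurable
          (hw.continuous_fderiv one_ne_zero).aestronglyMeasurable

theorem enorm_sq_le_of_contDiff {w : ℝ → ℂ} (hw : ContDiff ℝ 1 w) (hwc : HasCompactSupport w)
    (x : ℝ) : ‖w x‖ₑ ^ 2 ≤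
      2 * (eLpNorm w 2 volume * eLpNorm (fun x => fderiv ℝ w x 1) 2 volume) := by
  have h1 := (hwc.sq).enorm_le_lintegral_Ici_deriv (hw.pow 2) x
  have h2 : eLpNorm (fderiv ℝ w) 2 volume ≤ eLpNorm (fun x => fderiv ℝ w x 1) 2 volume :=
    eLpNorm_mono fun x => by simp [norm_deriv_eq_norm_fderiv]
  calc ‖w x‖ₑ ^ 2 = ‖w x ^ 2‖ₑ := (enorm_pow _ _).symm
    _ ≤ ∫⁻ y, ‖deriv (fun x => w x ^ 2) y‖ₑ :=
        h1.trans (lintegral_mono' Measure.restrict_le_self le_rfl)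
    _ = ∫⁻ y, ‖fderiv ℝ (fun x => w x ^ 2) y‖ₑ := by
        simp only [← ofReal_norm, norm_deriv_eq_norm_fderiv]
    _ ≤ _ := lintegral_enorm_fderiv_sq_le volume hw
    _ ≤ _ := by gcongr

theorem ae_enorm_sq_le_of_hasWeakLineDeriv {f g : ℝ → ℂ} (hf : MemLp f 2 volume)
    (hg : MemLp g 2 volume) (h : HasWeakLineDeriv volume f g 1) :
    ∀ᵐ x, ‖f x‖ₑ ^ 2 ≤ 2 * (eLpNorm f 2 volume * eLpNorm g 2 volume) := by
  obtain ⟨w, hw, hwc, hw2, hwd, hlim⟩ := exists_contDiff_compactSupport_approx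
    (ι := Unit) (e := fun _ => 1) (g := fun _ => g) hf (fun _ => hg) (fun _ => h)
  obtain ⟨δ, hδ, hwδ⟩ := hwd ()
  filter_upwards [hlim] with x hx
  have h1 : Tendsto (fun n => ‖w n x‖ₑ ^ 2) atTop (𝓝 (‖f x‖ₑ ^ 2)) :=
    ((ENNReal.continuous_pow 2).tendsto _).comp hx.enorm
  have h2 : Tendsto (fun n => 2 * (eLpNorm f 2 volume * (eLpNorm g 2 volume + δ n))) atTop
      (𝓝 (2 * (eLpNorm f 2 volume * (eLpNorm g 2 volume + 0)))) :=
    ENNReal.Tendsto.const_mul (ENNReal.Tendsto.const_mul (hδ.const_add _) (Or.inr hf.2.ne))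
      (Or.inr (by simp))
  rw [add_zero] at h2
  refine le_of_tendsto_of_tendsto' h1 h2 fun n => ?_
  refine (enorm_sq_le_of_contDiff (hw n) (hwc n) x).trans ?_
  gcongr
  · exact hw2 n
  · exact hwδ n

theorem eLpNorm_ofReal_rpow {α F : Type*} [MeasurableSpace α] [NormedAddCommGroup F]
    (f : α → F) (μ : Measure α) {p : ℝ} (hp : 0 < p) :
    eLpNorm f (ENNReal.ofReal p) μ ^ p = ∫⁻ x, ‖f x‖ₑ ^ p ∂μ := by
  have := eLpNorm_nnreal_pow_eq_lintegral (μ := μ) (f := f) (p := p.toNNReal)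
    (by simpa using hp)
  rwa [Real.coe_toNNReal _ hp.le] at this

/-- Factor `|f|^p = (|f|²)^(p/2-1) |f|²` and bound only the first factor by its essential supremum.
-/
theorem eLpNorm_rpow_le_line {f g : ℝ → ℂ} (hf : MemLp f 2 volume)
    (hg : MemLp g 2 volume) (h : HasWeakLineDeriv volume f g 1) {p : ℝ} (hp : 2 < p) :
    eLpNorm f (ENNReal.ofReal p) volume ^ p ≤
      (2 * (eLpNorm f 2 volume * eLpNorm g 2 volume)) ^ (p / 2 - 1) * eLpNorm f 2 volume ^ 2 := by
  rw [eLpNorm_ofReal_rpow _ _ (by linarith), eLpNorm_two_sq_eq_lintegral]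
  have hfin : (2 * (eLpNorm f 2 volume * eLpNorm g 2 volume)) ^ (p / 2 - 1) ≠ ⊤ :=
    ENNReal.rpow_ne_top_of_nonneg (by linarith)
      (ENNReal.mul_ne_top (by simp) (ENNReal.mul_ne_top hf.2.ne hg.2.ne))
  rw [← lintegral_const_mul' _ _ hfin]
  refine lintegral_mono_ae ?_
  filter_upwards [ae_enorm_sq_le_of_hasWeakLineDeriv hf hg h] with x hx
  calc ‖f x‖ₑ ^ p = (‖f x‖ₑ ^ 2) ^ (p / 2 - 1) * ‖f x‖ₑ ^ 2 := by
        rw [← ENNReal.rpow_natCast, ← ENNReal.rpow_mul,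
          ← ENNReal.rpow_add_of_nonneg _ _ (by push_cast; linarith) (by simp)]
        congr 1; push_cast; ring
    _ ≤ _ := by gcongr; linarith

theorem eLpNorm_fderiv_plane_le {w : Plane → ℂ} (hw : ContDiff ℝ 1 w) :
    eLpNorm (fderiv ℝ w) 2 volume ≤
      ∑ i, eLpNorm (fun x => fderiv ℝ w x (EuclideanSpace.single i 1)) 2 volume := by
  have h1 : ∀ x, ‖fderiv ℝ w x‖ ≤ ∑ i, ‖fderiv ℝ w x (EuclideanSpace.single i 1)‖ := by
    intro x
    refine ContinuousLinearMap.opNorm_le_bound _ (by positivity) fun v => ?_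
    have hv : v = ∑ i, v i • EuclideanSpace.single i (1 : ℝ) := by
      ext j; fin_cases j <;> simp
    conv_lhs => rw [hv, map_sum]
    rw [Finset.sum_mul]
    refine (norm_sum_le _ _).trans (Finset.sum_le_sum fun i _ => ?_)
    rw [map_smul, norm_smul, mul_comm]
    gcongr
    exact PiLp.norm_apply_le v i
  have hc : ∀ i : Fin 2, Continuous fun x => fderiv ℝ w x (EuclideanSpace.single i 1) :=
    fun i => (hw.continuous_fderiv one_ne_zero).clm_apply continuous_const
  calc _ ≤ eLpNorm (∑ i, fun x => ‖fderiv ℝ w x (EuclideanSpace.single i 1)‖) 2 volume :=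
        eLpNorm_mono_real fun x => by simpa using h1 x
    _ ≤ ∑ i, eLpNorm (fun x => ‖fderiv ℝ w x (EuclideanSpace.single i 1)‖) 2 volume :=
        eLpNorm_sum_le (fun i _ => (hc i).norm.aestronglyMeasurable) one_le_two
    _ = _ := by simp only [eLpNorm_norm]

/-- Ladyzhenskaya's inequality. -/
theorem exists_lintegral_pow_four_le : ∃ C : ℝ≥0, ∀ {f : Plane → ℂ} {g : Fin 2 → Plane → ℂ},
    MemLp f 2 volume → (∀ i, MemLp (g i) 2 volume) →
    (∀ i, HasWeakLineDeriv volume f (g i) (EuclideanSpace.single i 1)) →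
    ∫⁻ x, ‖f x‖ₑ ^ 4 ≤ C * (eLpNorm f 2 volume * ∑ i, eLpNorm (g i) 2 volume) ^ 2 := by
  have hconj : Real.HolderConjugate (Module.finrank ℝ Plane) 2 := by
    simpa using Real.HolderConjugate.two_two
  let K : ℝ≥0 := lintegralPowLePowLIntegralFDerivConst (volume : Measure Plane) 2
  refine ⟨K * 4, fun {f g} hf hg h => ?_⟩
  obtain ⟨w, hw, hwc, hw2, hwd, hlim⟩ := exists_contDiff_compactSupport_approx hf hg h
  choose δ hδ hwδ using hwd
  have hn : ∀ n, ∫⁻ x, ‖w n x‖ₑ ^ 4 ≤ ((K * 4 : ℝ≥0) : ℝ≥0∞) *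
      (eLpNorm f 2 volume * ∑ i, (eLpNorm (g i) 2 volume + δ i n)) ^ 2 := by
    intro n
    -- In dimension two the `W^{1,1}` Sobolev inequality lands in `L²`; for `w²` this is an `L⁴`
    -- bound on `w`.
    have h1 := lintegral_pow_le_pow_lintegral_fderiv (volume : Measure Plane) ((hw n).pow 2)
      (hwc n).sq hconj
    calc ∫⁻ x, ‖w n x‖ₑ ^ 4 = ∫⁻ x, ‖w n x ^ 2‖ₑ ^ (2 : ℝ) := by
          refine lintegral_congr fun x => ?_
          rw [enorm_pow, ENNReal.rpow_ofNat, ← pow_mul]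
      _ ≤ _ := h1
      _ ≤ K * (2 * (eLpNorm f 2 volume * ∑ i, (eLpNorm (g i) 2 volume + δ i n))) ^ (2 : ℝ) := by
          gcongr
          refine (lintegral_enorm_fderiv_sq_le volume (hw n)).trans ?_
          gcongr
          · exact hw2 n
          · exact (eLpNorm_fderiv_plane_le (hw n)).trans (Finset.sum_le_sum fun i _ => hwδ i n)
      _ = _ := by
          rw [ENNReal.rpow_ofNat, mul_pow]
          push_cast
          ring
  have hlim2 : Tendsto (fun n => ((K * 4 : ℝ≥0) : ℝ≥0∞) *
      (eLpNorm f 2 volume * ∑ i, (eLpNorm (g i) 2 volume + δ i n)) ^ 2) atTop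
      (𝓝 (((K * 4 : ℝ≥0) : ℝ≥0∞) *
        (eLpNorm f 2 volume * ∑ i, (eLpNorm (g i) 2 volume + 0)) ^ 2)) := by
    refine ENNReal.Tendsto.const_mul ?_ (Or.inr ENNReal.coe_ne_top)
    refine ((ENNReal.continuous_pow 2).tendsto _).comp ?_
    refine ENNReal.Tendsto.const_mul ?_ (Or.inr hf.2.ne)
    exact tendsto_finsetSum _ fun i _ => (hδ i).const_add _
  simp only [add_zero] at hlim2
  -- Fatou's lemma along the approximating sequence.
  calc ∫⁻ x, ‖f x‖ₑ ^ 4 = ∫⁻ x, liminf (fun n => ‖w n x‖ₑ ^ 4) atTop := by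
        refine lintegral_congr_ae ?_
        filter_upwards [hlim] with x hx
        exact (((ENNReal.continuous_pow 4).tendsto _).comp hx.enorm).liminf_eq.symm
    _ ≤ liminf (fun n => ∫⁻ x, ‖w n x‖ₑ ^ 4) atTop :=
        lintegral_liminf_le fun n => ((hw n).continuous.measurable.enorm.pow_const 4)
    _ ≤ _ := (liminf_le_liminf (Eventually.of_forall hn)).trans_eq hlim2.liminf_eq

/-- Hölder with `r = 2·(4-r)/2 + 4·(r-2)/2` interpolates between `L²` and Ladyzhenskaya's `L⁴`
bound; the powers of `‖f‖₂` add up to `(4-r) + (r-2) = 2`. -/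
theorem exists_eLpNorm_rpow_le_plane {r : ℝ} (hr : 2 < r) (hr4 : r < 4) :
    ∃ C : ℝ≥0, ∀ {f : Plane → ℂ} {G : Plane → EuclideanSpace ℂ (Fin 2)}, IsH1Plane f G →
      eLpNorm f (ENNReal.ofReal r) volume ^ r ≤
        C * eLpNorm f 2 volume ^ 2 * eLpNorm G 2 volume ^ (r - 2) := by
  obtain ⟨C, hC⟩ := exists_lintegral_pow_four_le
  -- The 4 is the square of the number of partial derivatives, each bounded by the full gradient.
  refine ⟨(C * 4) ^ ((r - 2) / 2), fun {f G} h => ?_⟩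
  have hGi : ∀ i, eLpNorm (fun x => G x i) 2 volume ≤ eLpNorm G 2 volume := fun i =>
    eLpNorm_mono fun x => PiLp.norm_apply_le (G x) i
  have hGm : ∀ i, MemLp (fun x => G x i) 2 volume := fun i =>
    h.memLp_grad.of_le ((EuclideanSpace.proj i).continuous.comp_aestronglyMeasurable h.memLp_grad.1)
      (ae_of_all _ fun x => PiLp.norm_apply_le (G x) i)
  have h4 : ∫⁻ x, ‖f x‖ₑ ^ 4 ≤ (C * 4) * eLpNorm f 2 volume ^ 2 * eLpNorm G 2 volume ^ 2 := by
    refine (hC h.memLp hGm fun i η hη hηc => h.weak_grad η hη hηc i).trans ?_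
    calc _ ≤ C * (eLpNorm f 2 volume * ∑ i : Fin 2, eLpNorm G 2 volume) ^ 2 := by
          gcongr with i; exact hGi i
      _ = _ := by simp; ring
  have hint := ENNReal.lintegral_mul_norm_pow_le (μ := volume) (f := fun x => ‖f x‖ₑ ^ 2)
    (g := fun x => ‖f x‖ₑ ^ 4) (p := (4 - r) / 2) (q := (r - 2) / 2)
    (h.memLp.1.enorm.pow_const 2) (h.memLp.1.enorm.pow_const 4) (by linarith) (by linarith)
    (by ring)
  have hfun : ∀ x, (‖f x‖ₑ ^ 2) ^ ((4 - r) / 2) * (‖f x‖ₑ ^ 4) ^ ((r - 2) / 2) = ‖f x‖ₑ ^ r := by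
    intro x
    rw [← ENNReal.rpow_natCast, ← ENNReal.rpow_natCast, ← ENNReal.rpow_mul, ← ENNReal.rpow_mul,
      ← ENNReal.rpow_add_of_nonneg _ _ (by push_cast; linarith) (by push_cast; linarith)]
    congr 1; push_cast; ring
  simp only [hfun] at hint
  rw [eLpNorm_ofReal_rpow _ _ (by linarith)]
  refine hint.trans ?_
  rw [← eLpNorm_two_sq_eq_lintegral]
  have hq : 0 ≤ (r - 2) / 2 := by linarith
  calc _ ≤ (eLpNorm f 2 volume ^ 2) ^ ((4 - r) / 2) *
        ((C * 4) * eLpNorm f 2 volume ^ 2 * eLpNorm G 2 volume ^ 2) ^ ((r - 2) / 2) := by gcongr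
    _ = ((C * 4 : ℝ≥0∞)) ^ ((r - 2) / 2) * ((eLpNorm f 2 volume ^ 2) ^ ((4 - r) / 2) *
        (eLpNorm f 2 volume ^ 2) ^ ((r - 2) / 2)) *
        (eLpNorm G 2 volume ^ 2) ^ ((r - 2) / 2) := by
        rw [ENNReal.mul_rpow_of_nonneg _ _ hq, ENNReal.mul_rpow_of_nonneg _ _ hq]; ring
    _ = _ := by
        rw [← ENNReal.rpow_add_of_nonneg _ _ (by linarith) hq, ENNReal.coe_rpow_of_nonneg _ hq,
          ← ENNReal.rpow_natCast (eLpNorm G 2 volume), ← ENNReal.rpow_mul]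
        rw [show (4 - r) / 2 + (r - 2) / 2 = 1 by ring, ENNReal.rpow_one]
        push_cast
        congr 2
        ring

end GagliardoNirenberg

/-! ### Integrability and scaling of `K₀`, and regularity of `K₀(as) - K₀(bs)`. -/

section Macdonald

theorem Real.one_add_sq_div_two_le_cosh (t : ℝ) : 1 + t ^ 2 / 2 ≤ Real.cosh t := by
  wlog ht : 0 ≤ t generalizing t
  · simpa using this (-t) (by linarith)
  have h1 : Real.cosh t = 1 + 2 * Real.sinh (t / 2) ^ 2 := by
    have := Real.cosh_two_mul (t / 2)
    rw [mul_div_cancel₀ _ two_ne_zero, Real.cosh_sq] at this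
    linarith
  have h2 : t / 2 ≤ Real.sinh (t / 2) := Real.self_le_sinh_iff.2 (by linarith)
  nlinarith

theorem exp_neg_mul_cosh_le {s : ℝ} (hs : 0 < s) (t : ℝ) :
    Real.exp (-(s * Real.cosh t)) ≤ Real.exp (-s) * Real.exp (-(s / 2) * t ^ 2) := by
  rw [← Real.exp_add, Real.exp_le_exp]
  nlinarith [Real.one_add_sq_div_two_le_cosh t]

theorem integrableOn_exp_neg_mul_cosh {s : ℝ} (hs : 0 < s) :
    IntegrableOn (fun t => Real.exp (-(s * Real.cosh t))) (Set.Ioi 0) := by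
  have hg := ((integrable_exp_neg_mul_sq (half_pos hs)).const_mul (Real.exp (-s))).integrableOn
    (s := Set.Ioi 0)
  refine hg.mono' (by fun_prop) (ae_of_all _ fun t => ?_)
  rw [Real.norm_of_nonneg (Real.exp_nonneg _)]
  exact exp_neg_mul_cosh_le hs t

theorem besselK0_nonneg (s : ℝ) : 0 ≤ besselK0 s :=
  integral_nonneg fun _ => Real.exp_nonneg _

theorem measurable_besselK0 : Measurable besselK0 := by
  have : StronglyMeasurable (Function.uncurry fun s t : ℝ => Real.exp (-(s * Real.cosh t))) := by
    apply Continuous.stronglyMeasurable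
    fun_prop
  exact this.integral_prod_right.measurable

/-- Replacing `cosh t` by `1 + t²/2` leaves a Gaussian integral. The power `s^(-1/2)` is cruder than
the true logarithm, but its `r`-th power is integrable near the origin of the plane exactly when `r
< 4`. -/
theorem besselK0_le {s : ℝ} (hs : 0 < s) :
    besselK0 s ≤ √(2 * Real.pi) / 2 * (s ^ (-(1 / 2) : ℝ) * Real.exp (-s)) := by
  have hg := ((integrable_exp_neg_mul_sq (half_pos hs)).const_mul (Real.exp (-s))).integrableOn
    (s := Set.Ioi 0)
  calc besselK0 s ≤ ∫ t in Set.Ioi (0 : ℝ), Real.exp (-s) * Real.exp (-(s / 2) * t ^ 2) :=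
        setIntegral_mono (integrableOn_exp_neg_mul_cosh hs) hg (exp_neg_mul_cosh_le hs)
    _ = Real.exp (-s) * (√(Real.pi / (s / 2)) / 2) := by
        rw [integral_const_mul, integral_gaussian_Ioi]
    _ = _ := by
        rw [show Real.pi / (s / 2) = (2 * Real.pi) * s⁻¹ by field_simp,
          Real.sqrt_mul (by positivity), Real.sqrt_inv, Real.rpow_neg hs.le, Real.sqrt_eq_rpow s]
        ring

/-- In polar coordinates the Jacobian `y` raises the exponent to `s + 1 > -1`. -/
theorem integrable_plane_of_norm_rpow_mul_exp {F : ℝ → ℝ} (hF : Measurable F) {C s b : ℝ}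
    (hs : -2 < s) (hb : 0 < b) (h : ∀ y, 0 < y → |F y| ≤ C * (y ^ s * Real.exp (-b * y))) :
    Integrable fun x : Plane => F ‖x‖ := by
  rw [integrable_fun_norm_addHaar (volume : Measure Plane) (f := F)]
  have h1 := (integrableOn_rpow_mul_exp_neg_mul_rpow (s := s + 1) (p := 1) (by linarith) one_pos
    hb).const_mul C
  refine Integrable.mono' h1 (by fun_prop) ?_
  filter_upwards [ae_restrict_mem measurableSet_Ioi] with y (hy : 0 < y)
  simp only [finrank_euclideanSpace, Fintype.card_fin, Nat.add_one_sub_one, pow_one, smul_eq_mul,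
    norm_mul, Real.norm_eq_abs, abs_of_pos hy, Real.rpow_one]
  rw [Real.rpow_add_one hy.ne']
  calc y * |F y| ≤ y * (C * (y ^ s * Real.exp (-b * y))) := by gcongr; exact h y hy
    _ = _ := by ring

theorem measurable_greenK0 (a : ℝ) : Measurable (greenK0 a) :=
  Complex.measurable_ofReal.comp
    ((measurable_besselK0.comp (measurable_norm.const_mul a)).div_const _)

theorem memLp_greenK0_one {r : ℝ} (hr : 0 < r) (hr4 : r < 4) :
    MemLp (greenK0 1) (ENNReal.ofReal r) volume := by
  rw [← integrable_norm_rpow_iff (measurable_greenK0 1).aestronglyMeasurable (by simpa using hr)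
    ENNReal.ofReal_ne_top, ENNReal.toReal_ofReal hr.le]
  let A : ℝ := √(2 * Real.pi) / 2 / (2 * Real.pi)
  have hA : 0 ≤ A := by positivity
  have hF : ∀ x, ‖greenK0 1 x‖ ^ r = (besselK0 ‖x‖ / (2 * Real.pi)) ^ r := fun x => by
    rw [greenK0, one_mul, Complex.norm_real, Real.norm_of_nonneg]
    exact div_nonneg (besselK0_nonneg _) (by positivity)
  simp only [hF]
  refine integrable_plane_of_norm_rpow_mul_exp (F := fun y => (besselK0 y / (2 * Real.pi)) ^ r)
    (C := A ^ r) (s := -(1 / 2) * r) (b := r) ((measurable_besselK0.div_const _).pow_const r)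
    (by linarith) hr fun y hy => ?_
  have h0 : 0 ≤ besselK0 y / (2 * Real.pi) := div_nonneg (besselK0_nonneg _) (by positivity)
  rw [abs_of_nonneg (by positivity)]
  calc (besselK0 y / (2 * Real.pi)) ^ r
      ≤ (A * (y ^ (-(1 / 2) : ℝ) * Real.exp (-y))) ^ r := by
        gcongr
        calc _ ≤ √(2 * Real.pi) / 2 * (y ^ (-(1 / 2) : ℝ) * Real.exp (-y)) / (2 * Real.pi) := by
              gcongr; exact besselK0_le hy
          _ = _ := by simp only [A]; ring
    _ = _ := by
        rw [Real.mul_rpow hA (by positivity), Real.mul_rpow (by positivity) (by positivity),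
          ← Real.rpow_mul hy.le, ← Real.exp_mul]
        congr 3; ring

theorem eLpNorm_greenK0_rpow {a r : ℝ} (ha : 0 < a) (hr : 0 < r) :
    eLpNorm (greenK0 a) (ENNReal.ofReal r) volume ^ r =
      ENNReal.ofReal (a ^ 2)⁻¹ * eLpNorm (greenK0 1) (ENNReal.ofReal r) volume ^ r := by
  rw [eLpNorm_ofReal_rpow _ _ hr, eLpNorm_ofReal_rpow _ _ hr]
  have h1 : ∀ x, greenK0 a x = greenK0 1 (a • x) := fun x => by
    simp [greenK0, norm_smul, abs_of_pos ha]
  simp only [h1]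
  rw [← lintegral_map (f := fun x => ‖greenK0 1 x‖ₑ ^ r) (g := fun x : Plane => a • x)
    ((measurable_greenK0 1).enorm.pow_const r) (measurable_const_smul a),
    Measure.map_addHaar_smul _ ha.ne', lintegral_smul_measure]
  simp

theorem memLp_greenK0 {a r : ℝ} (ha : 0 < a) (hr : 0 < r) (hr4 : r < 4) :
    MemLp (greenK0 a) (ENNReal.ofReal r) volume := by
  refine ⟨(measurable_greenK0 a).aestronglyMeasurable, ?_⟩
  rw [← ENNReal.rpow_lt_top_iff_of_pos hr, eLpNorm_greenK0_rpow ha hr]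
  exact ENNReal.mul_lt_top ENNReal.ofReal_lt_top
    ((ENNReal.rpow_lt_top_iff_of_pos hr).2 (memLp_greenK0_one hr hr4).2)

/-- The profile `ρ ↦ (exp(-aρ) - exp(-bρ)) / ρ`, extended continuously to `ρ = 0`. -/
noncomputable def yukawaDiff (a b ρ : ℝ) : ℝ := ∫ c in a..b, Real.exp (-(c * ρ))

theorem yukawaDiff_eq (a b ρ : ℝ) :
    ρ * yukawaDiff a b ρ = Real.exp (-(a * ρ)) - Real.exp (-(b * ρ)) := by
  have hd : ∀ c ∈ Set.uIcc a b,
      HasDerivAt (fun c => -Real.exp (-(c * ρ))) (ρ * Real.exp (-(c * ρ))) c := fun c _ => by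
    have := (((hasDerivAt_id c).mul_const ρ).neg.exp).neg
    exact this.congr_deriv (by simp [mul_comm])
  rw [yukawaDiff, ← intervalIntegral.integral_const_mul,
    intervalIntegral.integral_eq_sub_of_hasDerivAt hd
      (Continuous.intervalIntegrable (by fun_prop) _ _)]
  ring

theorem continuous_yukawaDiff (a b : ℝ) : Continuous (yukawaDiff a b) := by
  unfold yukawaDiff
  apply intervalIntegral.continuous_parametric_intervalIntegral_of_continuous'
  fun_prop

theorem abs_yukawaDiff_le {a b ρ : ℝ} (hρ : 0 ≤ ρ) :
    |yukawaDiff a b ρ| ≤ Real.exp (-(min a b * ρ)) * |b - a| := by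
  rw [← Real.norm_eq_abs, yukawaDiff]
  refine intervalIntegral.norm_integral_le_of_norm_le_const fun c hc => ?_
  rw [Real.norm_of_nonneg (Real.exp_nonneg _)]
  gcongr
  exact hc.1.le

theorem abs_exp_neg_mul_sub_le {c m x y : ℝ} (hc : 0 ≤ c) (hx : m ≤ x) (hy : m ≤ y) :
    |Real.exp (-(c * x)) - Real.exp (-(c * y))| ≤ c * |x - y| * Real.exp (-(c * m)) := by
  wlog hxy : x ≤ y generalizing x y
  · rw [abs_sub_comm, abs_sub_comm x]
    exact this hy hx (le_of_not_ge hxy)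
  have h1 : Real.exp (-(c * y)) = Real.exp (-(c * x)) * Real.exp (-(c * (y - x))) := by
    rw [← Real.exp_add]; congr 1; ring
  have h2 := Real.add_one_le_exp (-(c * (y - x)))
  have h3 : Real.exp (-(c * x)) ≤ Real.exp (-(c * m)) := by gcongr
  have h4 : 0 ≤ c * (y - x) := mul_nonneg hc (by linarith)
  rw [abs_of_nonneg (sub_nonneg.2 (by gcongr)), abs_of_nonpos (by linarith), h1]
  calc _ = Real.exp (-(c * x)) * (1 - Real.exp (-(c * (y - x)))) := by ring
    _ ≤ Real.exp (-(c * m)) * (c * (y - x)) :=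
        mul_le_mul h3 (by linarith) (sub_nonneg.2 (Real.exp_le_one_iff.2 (by linarith)))
          (Real.exp_nonneg _)
    _ = _ := by ring

theorem abs_yukawaDiff_sub_le {a b m x y : ℝ} (ha : 0 < a) (hb : 0 < b) (hm : 0 ≤ m) (hx : m ≤ x)
    (hy : m ≤ y) : |yukawaDiff a b x - yukawaDiff a b y| ≤
      max a b * |x - y| * Real.exp (-(min a b * m)) * |b - a| := by
  rw [yukawaDiff, yukawaDiff, ← intervalIntegral.integral_sub
    (Continuous.intervalIntegrable (by fun_prop) _ _)
    (Continuous.intervalIntegrable (by fun_prop) _ _), ← Real.norm_eq_abs]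
  refine intervalIntegral.norm_integral_le_of_norm_le_const fun c hc => ?_
  have hc0 : 0 ≤ c := (lt_min ha hb).le.trans hc.1.le
  refine (abs_exp_neg_mul_sub_le hc0 hx hy).trans ?_
  gcongr
  · exact hc.2
  · exact hc.1.le

/-- An integral representation of `K₀(as) - K₀(bs)` that makes sense at `s = 0`. -/
noncomputable def besselDiff (a b s : ℝ) : ℝ :=
  ∫ y in Set.Ioi (0 : ℝ), yukawaDiff a b (√(s ^ 2 + y ^ 2))

/-- This splits exponential decay in `√(s² + y²)` into decay in `s` times decay in `y`. -/
theorem add_div_two_le_sqrt (s y : ℝ) : (s + y) / 2 ≤ √(s ^ 2 + y ^ 2) :=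
  Real.le_sqrt_of_sq_le (by nlinarith [sq_nonneg (s - y), sq_nonneg (s + y)])

theorem abs_sqrt_sub_sqrt_le (s t y : ℝ) : |√(s ^ 2 + y ^ 2) - √(t ^ 2 + y ^ 2)| ≤ |s - t| := by
  rw [← Complex.norm_add_mul_I, ← Complex.norm_add_mul_I]
  refine (abs_norm_sub_norm_le _ _).trans_eq ?_
  rw [add_sub_add_right_eq_sub, ← Complex.ofReal_sub, Complex.norm_real, Real.norm_eq_abs]

theorem integrableOn_yukawaDiff_sqrt {a b : ℝ} (ha : 0 < a) (hb : 0 < b) (s : ℝ) :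
    IntegrableOn (fun y => yukawaDiff a b (√(s ^ 2 + y ^ 2))) (Set.Ioi 0) := by
  refine Integrable.mono' ((exp_neg_integrableOn_Ioi 0 (lt_min ha hb)).mul_const |b - a|)
    ((continuous_yukawaDiff a b).comp (by fun_prop)).aestronglyMeasurable ?_
  filter_upwards [ae_restrict_mem measurableSet_Ioi] with y (hy : 0 < y)
  refine (abs_yukawaDiff_le (Real.sqrt_nonneg _)).trans ?_
  rw [neg_mul]
  have h1 : y ≤ √(s ^ 2 + y ^ 2) := Real.le_sqrt_of_sq_le (by nlinarith [sq_nonneg s])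
  have h2 := lt_min ha hb
  gcongr

/-- The integrand is Lipschitz in `s` with constant decaying in `√(s² + y²)`. Half of the decay is
kept as `exp(-(min a b / 2) m)`; the other half makes the `y`-integral converge. -/
theorem exists_abs_besselDiff_sub_le {a b : ℝ} (ha : 0 < a) (hb : 0 < b) :
    ∃ A, 0 ≤ A ∧ ∀ m s t, m ≤ s → m ≤ t →
      |besselDiff a b s - besselDiff a b t| ≤ A * Real.exp (-(min a b / 2 * m)) * |s - t| := by
  have hk : 0 < min a b := lt_min ha hb
  refine ⟨max a b * |b - a| * ∫ y in Set.Ioi (0 : ℝ), Real.exp (-(min a b / 2) * y),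
    by positivity, fun m s t hs ht => ?_⟩
  rw [besselDiff, besselDiff, ← integral_sub (integrableOn_yukawaDiff_sqrt ha hb s)
    (integrableOn_yukawaDiff_sqrt ha hb t), ← Real.norm_eq_abs]
  have hint := (exp_neg_integrableOn_Ioi 0 (half_pos hk)).const_mul
    (max a b * |b - a| * Real.exp (-(min a b / 2 * m)) * |s - t|)
  refine (norm_integral_le_of_norm_le hint ?_).trans_eq ?_
  · filter_upwards [ae_restrict_mem measurableSet_Ioi] with y (hy : 0 < y)
    -- The maximum with 0 is needed because `m` may be negative.
    have h1 : max 0 ((m + y) / 2) ≤ √(s ^ 2 + y ^ 2) :=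
      max_le (Real.sqrt_nonneg _) ((add_div_two_le_sqrt s y).trans' (by linarith))
    have h2 : max 0 ((m + y) / 2) ≤ √(t ^ 2 + y ^ 2) :=
      max_le (Real.sqrt_nonneg _) ((add_div_two_le_sqrt t y).trans' (by linarith))
    refine (abs_yukawaDiff_sub_le ha hb (le_max_left _ _) h1 h2).trans ?_
    calc _ ≤ max a b * |s - t| * Real.exp (-(min a b * ((m + y) / 2))) * |b - a| := by
          gcongr max a b * ?_ * Real.exp (-(min a b * ?_)) * |b - a|
          · exact abs_sqrt_sub_sqrt_le s t y
          · exact le_max_right _ _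
      _ = max a b * |s - t| * (Real.exp (-(min a b / 2 * m)) *
            Real.exp (-(min a b / 2) * y)) * |b - a| := by
          rw [← Real.exp_add]; congr 3; ring
      _ = _ := by ring
  · rw [integral_const_mul]; ring

/-- Substitute `y = s sinh t`: then `√(s² + y²) = s cosh t = dy/dt`, and this Jacobian cancels the
denominator of the profile. -/
theorem besselDiff_eq {a b s : ℝ} (ha : 0 < a) (hb : 0 < b) (hs : 0 < s) :
    besselDiff a b s = besselK0 (a * s) - besselK0 (b * s) := by
  have himage : (fun t => s * Real.sinh t) '' Set.Ioi 0 = Set.Ioi 0 := by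
    ext y
    constructor
    · rintro ⟨t, ht, rfl⟩
      exact mul_pos hs (Real.sinh_pos_iff.2 ht)
    · intro hy
      refine ⟨Real.arsinh (y / s), Real.arsinh_pos_iff.2 (div_pos hy hs), ?_⟩
      simp only [Real.sinh_arsinh]
      field_simp
  have hchange := integral_image_eq_integral_abs_deriv_smul (s := Set.Ioi (0 : ℝ))
    measurableSet_Ioi
    (fun t _ => ((Real.hasDerivAt_sinh t).const_mul s).hasDerivWithinAt)
    (fun t _ t' _ h => Real.sinh_injective (mul_left_cancel₀ hs.ne' h))
    (fun y => yukawaDiff a b (√(s ^ 2 + y ^ 2)))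
  rw [himage] at hchange
  rw [besselDiff, hchange, besselK0, besselK0,
    ← integral_sub (integrableOn_exp_neg_mul_cosh (mul_pos ha hs))
      (integrableOn_exp_neg_mul_cosh (mul_pos hb hs))]
  refine integral_congr_ae (ae_of_all _ fun t => ?_)
  have hc : 0 < s * Real.cosh t := mul_pos hs (Real.cosh_pos t)
  have h1 : √(s ^ 2 + (s * Real.sinh t) ^ 2) = s * Real.cosh t := by
    rw [show s ^ 2 + (s * Real.sinh t) ^ 2 = (s * Real.cosh t) ^ 2 by
      rw [mul_pow, mul_pow, Real.cosh_sq]; ring, Real.sqrt_sq hc.le]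
  simp only [h1, abs_of_pos hc, smul_eq_mul, yukawaDiff_eq]
  ring_nf

end Macdonald

/-! ### The regular part in `H¹(ℝ²)`, and the final estimates. -/

section EnergyDomain

theorem MeasureTheory.MemLp.integrable_smul_of_hasCompactSupport {E : Type*}
    [NormedAddCommGroup E] [NormedSpace ℝ E] [FiniteDimensional ℝ E] [MeasurableSpace E]
    [BorelSpace E] {μ : Measure E} [IsFiniteMeasureOnCompacts μ] {f : E → ℂ} (hf : MemLp f 2 μ)
    {η : E → ℝ} (hη : Continuous η) (hηc : HasCompactSupport η) :
    Integrable (fun x => η x • f x) μ :=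
  (hf.locallyIntegrable one_le_two).integrable_smul_left_of_hasCompactSupport hη hηc

theorem IsH1Plane.congr_ae {f g : Plane → ℂ} {G : Plane → EuclideanSpace ℂ (Fin 2)}
    (h : IsH1Plane f G) (hfg : f =ᵐ[volume] g) : IsH1Plane g G where
  memLp := h.memLp.ae_eq hfg
  memLp_grad := h.memLp_grad
  weak_grad η hη hηc i := by
    rw [← h.weak_grad η hη hηc i]
    refine integral_congr_ae ?_
    filter_upwards [hfg] with x hx
    rw [hx]

theorem IsH1Plane.add {f g : Plane → ℂ} {F G : Plane → EuclideanSpace ℂ (Fin 2)}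
    (hf : IsH1Plane f F) (hg : IsH1Plane g G) :
    IsH1Plane (fun x => f x + g x) (fun x => F x + G x) where
  memLp := hf.memLp.add hg.memLp
  memLp_grad := hf.memLp_grad.add hg.memLp_grad
  weak_grad η hη hηc i := by
    have hη1 : ContDiff ℝ 1 η := hη.of_le (by exact_mod_cast le_top)
    have hd : Continuous fun x => fderiv ℝ η x (EuclideanSpace.single i 1) :=
      (hη1.continuous_fderiv one_ne_zero).clm_apply continuous_const
    have hdc : HasCompactSupport fun x => fderiv ℝ η x (EuclideanSpace.single i 1) :=
      (hηc.fderiv ℝ).comp_left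
        (g := fun L : Plane →L[ℝ] ℝ => L (EuclideanSpace.single i 1)) (by simp)
    simp only [smul_add, PiLp.add_apply]
    rw [integral_add (hf.memLp.integrable_smul_of_hasCompactSupport hd hdc)
        (hg.memLp.integrable_smul_of_hasCompactSupport hd hdc),
      integral_add ((hf.memLp_grad.eval_piLp i).integrable_smul_of_hasCompactSupport
          hη.continuous hηc)
        ((hg.memLp_grad.eval_piLp i).integrable_smul_of_hasCompactSupport hη.continuous hηc),
      hf.weak_grad η hη hηc i, hg.weak_grad η hη hηc i]
    ring

theorem isH1Plane_of_lipschitz {W : Plane → ℝ} {K : ℝ≥0} (hW : LipschitzWith K W) (c : ℂ)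
    (hW2 : MemLp W 2 volume)
    (hdW : ∀ i : Fin 2, MemLp (fun x => lineDeriv ℝ W x (EuclideanSpace.single i 1)) 2 volume) :
    IsH1Plane (fun x => c * (W x : ℂ))
      (fun x => WithLp.toLp 2 fun i =>
        c * ((lineDeriv ℝ W x (EuclideanSpace.single i 1) : ℝ) : ℂ)) where
  memLp := hW2.ofReal.const_mul c
  memLp_grad := MemLp.of_eval_piLp fun i => (hdW i).ofReal.const_mul c
  weak_grad η hη hηc i := by
    have hη1 : ContDiff ℝ 1 η := hη.of_le (by exact_mod_cast le_top)
    obtain ⟨D, hD⟩ := hη1.lipschitzWith_of_hasCompactSupport hηc one_ne_zero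
    have h := hW.integral_lineDeriv_mul_eq (μ := volume) hD hηc (EuclideanSpace.single i 1)
    simp only [((hη1.differentiable one_ne_zero) _).lineDeriv_eq_fderiv, map_neg, neg_mul,
      integral_neg] at h
    have h1 : ∀ x, fderiv ℝ η x (EuclideanSpace.single i 1) • (c * (W x : ℂ)) =
        c * ((fderiv ℝ η x (EuclideanSpace.single i 1) * W x : ℝ) : ℂ) := fun x => by
      rw [Complex.real_smul]; push_cast; ring
    have h2 : ∀ x, η x • (c * ((lineDeriv ℝ W x (EuclideanSpace.single i 1) : ℝ) : ℂ)) =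
        c * ((lineDeriv ℝ W x (EuclideanSpace.single i 1) * η x : ℝ) : ℂ) := fun x => by
      rw [Complex.real_smul]; push_cast; ring
    simp only [h1, h2]
    rw [integral_const_mul, integral_const_mul, integral_complex_ofReal, integral_complex_ofReal,
      h]
    push_cast
    ring

theorem exists_isH1Plane_greenK0_sub {a b : ℝ} (ha : 0 < a) (hb : 0 < b) (q : ℂ) :
    ∃ G, IsH1Plane (fun x => q * (greenK0 a x - greenK0 b x)) G := by
  obtain ⟨A, hA, hlip⟩ := exists_abs_besselDiff_sub_le ha hb
  let k : ℝ := min a b / 2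
  have hk : 0 < k := half_pos (lt_min ha hb)
  let W : Plane → ℝ := fun x => besselDiff a b ‖x‖ / (2 * Real.pi)
  have hpi : 1 ≤ 2 * Real.pi := by linarith [Real.two_le_pi]
  have hWlip : ∀ m (x y : Plane), m ≤ ‖x‖ → m ≤ ‖y‖ →
      ‖W x - W y‖ ≤ A * Real.exp (-(k * m)) * ‖x - y‖ := by
    intro m x y hx hy
    rw [← sub_div, norm_div, Real.norm_of_nonneg (by positivity : 0 ≤ 2 * Real.pi)]
    refine (div_le_self (norm_nonneg _) hpi).trans ((hlip m _ _ hx hy).trans ?_)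
    gcongr A * Real.exp (-(k * m)) * ?_
    exact abs_norm_sub_norm_le x y
  have hWL : LipschitzWith A.toNNReal W := LipschitzWith.of_dist_le_mul fun x y => by
    simpa [dist_eq_norm, Real.coe_toNNReal _ hA] using
      hWlip 0 x y (norm_nonneg _) (norm_nonneg _)
  have hWeq : (fun x => (W x : ℂ)) =ᵐ[volume] fun x => greenK0 a x - greenK0 b x := by
    filter_upwards [Measure.ae_ne volume (0 : Plane)] with x hx
    simp only [W, greenK0, besselDiff_eq ha hb (norm_pos_iff.2 hx)]
    push_cast
    ring
  have htwo : ENNReal.ofReal 2 = 2 := by simp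
  have hmem : MemLp (fun x => greenK0 a x - greenK0 b x) 2 volume := by
    have h1 := memLp_greenK0 ha two_pos (by norm_num)
    have h2 := memLp_greenK0 hb two_pos (by norm_num)
    rw [htwo] at h1 h2
    exact h1.sub h2
  have hW2 : MemLp W 2 volume := (hmem.ae_eq hWeq.symm).re
  -- This dominates the derivative at `x`: on the unit ball about `x` norms exceed `‖x‖ - 1`, which
  -- costs the factor `exp k`.
  have hexp : MemLp (fun x : Plane => A * Real.exp k * Real.exp (-(k * ‖x‖))) 2 volume := by
    have hm : AEStronglyMeasurable (fun x : Plane => A * Real.exp k * Real.exp (-(k * ‖x‖)))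
        volume := by
      apply Continuous.aestronglyMeasurable; fun_prop
    rw [memLp_two_iff_integrable_sq hm]
    refine integrable_plane_of_norm_rpow_mul_exp
      (F := fun y => (A * Real.exp k * Real.exp (-(k * y))) ^ 2) (C := (A * Real.exp k) ^ 2)
      (s := 0) (b := 2 * k) (by fun_prop) (by norm_num) (by positivity) fun y _ => ?_
    rw [abs_of_nonneg (by positivity), mul_pow, ← Real.exp_nat_mul, Real.rpow_zero, one_mul]
    apply le_of_eq
    congr 2
    push_cast; ring
  have hdW : ∀ i : Fin 2,
      MemLp (fun x => lineDeriv ℝ W x (EuclideanSpace.single i 1)) 2 volume := by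
    intro i
    refine hexp.mono' (measurable_lineDeriv hWL.continuous).aestronglyMeasurable
      (ae_of_all _ fun x => ?_)
    have hnear : ∀ᶠ y in 𝓝 x, ‖W y - W x‖ ≤ A * Real.exp (-(k * (‖x‖ - 1))) * ‖y - x‖ := by
      filter_upwards [Metric.ball_mem_nhds x one_pos] with y hy
      rw [Metric.mem_ball, dist_eq_norm, ← norm_neg, neg_sub] at hy
      exact hWlip _ y x (by linarith [norm_sub_norm_le x y]) (by linarith)
    refine (norm_lineDeriv_le_of_lip' ℝ (by positivity) hnear).trans_eq ?_
    rw [PiLp.norm_single, norm_one, mul_one, mul_assoc, ← Real.exp_add]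
    congr 2; ring
  exact ⟨_, (isH1Plane_of_lipschitz hWL q hW2 hdW).congr_ae
    (hWeq.mono fun x hx => by simp only [hx])⟩

/-- For `q ≠ 0`, `φ_q = φ + q (G_1 - G_{|q|})` almost everywhere. -/
theorem HasCharge.exists_isH1Plane_regularPart {v : Plane → ℂ} {q : ℂ} (h : HasCharge v q) :
    ∃ G, IsH1Plane (regularPart v q) G := by
  obtain ⟨φ, F, hφ, hv⟩ := h
  by_cases hq : q = 0
  · exact ⟨F, hφ.congr_ae (hv.mono fun x hx => by simp [regularPart, hq, hx])⟩
  · obtain ⟨G, hG⟩ := exists_isH1Plane_greenK0_sub one_pos (norm_pos_iff.2 hq) q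
    refine ⟨_, (hφ.add hG).congr_ae (hv.mono fun x hx => ?_)⟩
    simp only [regularPart, hq, if_false, hx]
    ring

theorem eLpNorm_charge_mul_greenK0_rpow {q : ℂ} (hq : q ≠ 0) {r : ℝ} (hr : 0 < r) :
    eLpNorm (fun x => q * greenK0 ‖q‖ x) (ENNReal.ofReal r) volume ^ r =
      ‖q‖ₑ ^ (r - 2) * eLpNorm (greenK0 1) (ENNReal.ofReal r) volume ^ r := by
  have h1 : eLpNorm (fun x => q * greenK0 ‖q‖ x) (ENNReal.ofReal r) volume =
      ‖q‖ₑ * eLpNorm (greenK0 ‖q‖) (ENNReal.ofReal r) volume :=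
    eLpNorm_const_smul q (greenK0 ‖q‖) _ _
  have hq0 : ‖q‖ₑ ≠ 0 := by simpa using hq
  rw [h1, ENNReal.mul_rpow_of_nonneg _ _ hr.le, eLpNorm_greenK0_rpow (norm_pos_iff.2 hq) hr,
    ← mul_assoc, ENNReal.ofReal_inv_of_pos (by positivity), ENNReal.ofReal_pow (norm_nonneg _),
    ofReal_norm, ENNReal.rpow_sub _ _ hq0 enorm_ne_top, ENNReal.rpow_ofNat, div_eq_mul_inv]

theorem eLpNorm_two_le_of_mem {μ : ℝ} {u : ℝ → ℂ} {v : Plane → ℂ}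
    (h : (u, v) ∈ energyDomainMass μ) :
    eLpNorm u 2 volume ^ 2 ≤ ENNReal.ofReal μ ∧ eLpNorm v 2 volume ^ 2 ≤ ENNReal.ofReal μ := by
  rw [eLpNorm_two_sq_eq_lintegral, eLpNorm_two_sq_eq_lintegral, ← h.2]
  exact ⟨le_self_add, le_add_self⟩

/-- The `L²` norm of `q G_{|q|}` is scale invariant, so the bound is uniform in the charge. -/
theorem HasCharge.eLpNorm_regularPart_le {v : Plane → ℂ} {q : ℂ} (h : HasCharge v q) :
    eLpNorm (regularPart v q) 2 volume ≤ eLpNorm v 2 volume + eLpNorm (greenK0 1) 2 volume := by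
  by_cases hq : q = 0
  · rw [show regularPart v q = v from funext fun x => by simp [regularPart, hq]]
    exact le_self_add
  · obtain ⟨G, hG⟩ := h.exists_isH1Plane_regularPart
    have hgreen : AEStronglyMeasurable (fun x => q * greenK0 ‖q‖ x) volume :=
      ((measurable_greenK0 ‖q‖).const_mul q).aestronglyMeasurable
    have heq : regularPart v q = v - fun x => q * greenK0 ‖q‖ x := by
      ext x; simp [regularPart, hq]
    have hv : AEStronglyMeasurable v volume := by
      have := hG.memLp.1.add hgreen
      rwa [heq, sub_add_cancel] at this
    rw [heq]
    refine (eLpNorm_sub_le hv hgreen one_le_two).trans ?_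
    gcongr
    have h2 := eLpNorm_charge_mul_greenK0_rpow hq two_pos
    rw [sub_self, ENNReal.rpow_zero, one_mul, show ENNReal.ofReal 2 = 2 by simp] at h2
    exact ((ENNReal.rpow_left_injective two_ne_zero) h2).le

theorem proposition3p1 :
    (∀ p : ℝ, 2 < p → p < 6 → ∀ μ : ℝ, 0 < μ →
      ∃ C : ℝ≥0, ∀ (u : ℝ → ℂ) (v : Plane → ℂ), (u, v) ∈ energyDomainMass μ →
        ∀ u' : ℝ → ℂ, IsH1Line u u' →
          eLpNorm u (ENNReal.ofReal p) volume ^ p ≤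
            (C : ℝ≥0∞) * eLpNorm u' 2 volume ^ (p / 2 - 1)) ∧
    (∀ r : ℝ, 2 < r → r < 4 → ∀ μ : ℝ, 0 < μ →
      ∃ C : ℝ≥0, ∀ (u : ℝ → ℂ) (v : Plane → ℂ), (u, v) ∈ energyDomainMass μ →
        ∀ q : ℂ, HasCharge v q →
          (∃ G, IsH1Plane (regularPart v q) G) ∧
          ∀ G, IsH1Plane (regularPart v q) G →
            eLpNorm v (ENNReal.ofReal r) volume ^ r ≤
              (C : ℝ≥0∞) * (eLpNorm G 2 volume ^ (r - 2) + ‖q‖ₑ ^ (r - 2))) := by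
  have hroot : ∀ {x m : ℝ≥0∞}, x ^ 2 ≤ m → x ≤ m ^ (1 / 2 : ℝ) := fun {x m} h => by
    rw [one_div, ENNReal.le_rpow_inv_iff two_pos]
    simpa using h
  have htop : ∀ m : ℝ, ENNReal.ofReal m ^ (1 / 2 : ℝ) ≠ ⊤ := fun m =>
    ENNReal.rpow_ne_top_of_nonneg (by norm_num) ENNReal.ofReal_ne_top
  refine ⟨fun p hp _ μ _ => ?_, fun r hr hr4 μ _ => ?_⟩
  · have hp' : 0 ≤ p / 2 - 1 := by linarith
    let C : ℝ≥0∞ := (2 * ENNReal.ofReal μ ^ (1 / 2 : ℝ)) ^ (p / 2 - 1) * ENNReal.ofReal μ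
    have hC : C ≠ ⊤ := ENNReal.mul_ne_top
      (ENNReal.rpow_ne_top_of_nonneg hp' (ENNReal.mul_ne_top (by simp) (htop μ)))
      ENNReal.ofReal_ne_top
    refine ⟨C.toNNReal, fun u v huv u' hu => ?_⟩
    rw [ENNReal.coe_toNNReal hC]
    have hu2 := (eLpNorm_two_le_of_mem huv).1
    have hweak : HasWeakLineDeriv volume u u' 1 := fun η hη hηc => by
      simpa only [fderiv_eq_deriv_mul, mul_one] using
        hu.weak_deriv η hη hηc
    calc _ ≤ _ := eLpNorm_rpow_le_line hu.memLp hu.memLp_deriv hweak hp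
      _ ≤ (2 * (ENNReal.ofReal μ ^ (1 / 2 : ℝ) * eLpNorm u' 2 volume)) ^ (p / 2 - 1) *
          ENNReal.ofReal μ := by
          gcongr
          exact hroot hu2
      _ = _ := by
          rw [← mul_assoc, ENNReal.mul_rpow_of_nonneg _ _ hp']
          simp only [C]
          ring
  · obtain ⟨C, hC⟩ := exists_eLpNorm_rpow_le_plane hr hr4
    have hr0 : 0 < r := by linarith
    let M : ℝ≥0∞ := ENNReal.ofReal μ ^ (1 / 2 : ℝ) + eLpNorm (greenK0 1) 2 volume
    let B : ℝ≥0∞ := eLpNorm (greenK0 1) (ENNReal.ofReal r) volume ^ r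
    -- The factor `2^(r-1)` comes from convexity of `x ↦ x^r`; the sum dominates the coefficients of
    -- both the regular and the singular term.
    let D : ℝ≥0∞ := 2 ^ (r - 1) * (C * M ^ 2 + B)
    have hM : M ≠ ⊤ := by
      have := memLp_greenK0_one two_pos (by norm_num : (2 : ℝ) < 4)
      rw [show ENNReal.ofReal 2 = 2 by simp] at this
      exact ENNReal.add_ne_top.2 ⟨htop μ, this.2.ne⟩
    have hB : B ≠ ⊤ := ENNReal.rpow_ne_top_of_nonneg hr0.le (memLp_greenK0_one hr0 hr4).2.ne
    have hD : D ≠ ⊤ := ENNReal.mul_ne_top (ENNReal.rpow_ne_top_of_nonneg (by linarith) (by simp))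
      (ENNReal.add_ne_top.2
        ⟨ENNReal.mul_ne_top ENNReal.coe_ne_top (ENNReal.pow_ne_top hM), hB⟩)
    refine ⟨D.toNNReal, fun u v huv q hq => ⟨hq.exists_isH1Plane_regularPart, fun G hG => ?_⟩⟩
    rw [ENNReal.coe_toNNReal hD]
    have hreg2 : eLpNorm (regularPart v q) 2 volume ≤ M :=
      hq.eLpNorm_regularPart_le.trans (add_le_add (hroot (eLpNorm_two_le_of_mem huv).2) le_rfl)
    have hreg : eLpNorm (regularPart v q) (ENNReal.ofReal r) volume ^ r ≤
        C * M ^ 2 * eLpNorm G 2 volume ^ (r - 2) := by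
      refine (hC hG).trans ?_
      gcongr
    have hsing : eLpNorm (fun x => v x - regularPart v q x) (ENNReal.ofReal r) volume ^ r ≤
        B * ‖q‖ₑ ^ (r - 2) := by
      by_cases hq0 : q = 0
      · simp [regularPart, hq0, hr0]
      · rw [mul_comm, ← eLpNorm_charge_mul_greenK0_rpow hq0 hr0]
        simp [regularPart, hq0]
    have hmeas : AEStronglyMeasurable (fun x => v x - regularPart v q x) volume := by
      by_cases hq0 : q = 0
      · simpa [regularPart, hq0] using aestronglyMeasurable_const
      · simpa [regularPart, hq0] using
          ((measurable_greenK0 ‖q‖).const_mul q).aestronglyMeasurable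
    have hsum : v = regularPart v q + fun x => v x - regularPart v q x := by
      ext x; simp
    calc eLpNorm v (ENNReal.ofReal r) volume ^ r
        ≤ (eLpNorm (regularPart v q) (ENNReal.ofReal r) volume +
          eLpNorm (fun x => v x - regularPart v q x) (ENNReal.ofReal r) volume) ^ r := by
          conv_lhs => rw [hsum]
          gcongr
          exact eLpNorm_add_le hG.memLp.1 hmeas (by simpa using (by linarith : 1 ≤ r))
      _ ≤ 2 ^ (r - 1) * (eLpNorm (regularPart v q) (ENNReal.ofReal r) volume ^ r +
          eLpNorm (fun x => v x - regularPart v q x) (ENNReal.ofReal r) volume ^ r) :=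
          ENNReal.rpow_add_le_mul_rpow_add_rpow _ _ (by linarith)
      _ ≤ 2 ^ (r - 1) * (C * M ^ 2 * eLpNorm G 2 volume ^ (r - 2) + B * ‖q‖ₑ ^ (r - 2)) := by
          gcongr
      _ ≤ 2 ^ (r - 1) * ((C * M ^ 2 + B) * eLpNorm G 2 volume ^ (r - 2) +
          (C * M ^ 2 + B) * ‖q‖ₑ ^ (r - 2)) := by
          gcongr
          · exact le_self_add
          · exact le_add_self
      _ = _ := by simp only [D]; ring

end EnergyDomain
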